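/- Let $X \subseteq \mathbb{R}^n$ be open, let $U \subseteq \mathbb{R}^m$, let $f : X \to \mathbb{R}^n$ and $g : X \to \mathbb{R}^{n\times m}$ be locally Lipschitz, and consider the control system $\dot x = f(x) + g(x)u$ with state $x \in X$ and input $u \in U$. Let $h : X \to \mathbb{R}$ be continuously differentiable, $C = \{x \in X : h(x) \ge 0\}$, and, for given $a, b > 0$, $A = \{x \in X : h(x) \in [-b,a]\}$. Let $\alpha : \mathbb{R} \to \mathbb{R}$ be continuous with $\alpha(0)=0$ and strictly increasing on $[0,\infty)$. Write $L_f h = \frac{\partial h}{\partial x} f$ and $L_g h = \frac{\partial h}{\partial x} g$. Suppose that $h$ is a Type-II ZCBF (zeroing control barrier function) for $\alpha$ and $A$, i.e. $$\sup_{v \in U}\,[L_f h(x) + L_g h(x) v + \alpha(h(x))] \ge 0 \quad \text{for all } x \in A,$$ and that $\nabla h(x) \ne 0$ for every $x \in X \cap \partial C$. For $x \in X$ let $S(x)$ be the set of all $v \in U$ such that, if $x \in A$, then $L_f h(x) + L_g h(x) v + \alpha(h(x)) \ge 0$. Let $u : X \to \mathbb{R}^m$ be any locally Lipschitz map with $u(x)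 \in S(x)$ for all $x \in X$, and put $F(x) = f(x) + g(x)u(x)$. (i) The closed-loop system $\dot x = F(x)$ is safe with respect to $C$: every solution with $x(0) \in C$ satisfies $x(t) \in C$ for all $t \ge 0$ in its interval of existence. (ii) Let $D = C \cup A$. Suppose in addition that $A$ is compact, that $\alpha(r) \le 0$ for all $r < 0$, that from every point of $D$ there starts a closed-loop solution that is defined and bounded for all $t \ge 0$, that $D$ is connected, and that no closed-loop solution can stay identically in $\Omega = \{x \in D \setminus C : \nabla h(x)^{T} F(x) = 0\}$, i.e. for every closed-loop solution $x$ on $[0,\infty)$ and every $\tau_1 \ge 0$ with $x(\tau_1) \in \Omega$ there is a $\tau_2 > \tau_1$ with $x(\tau_2) \notin \Omega$. Then $C$ is asymptotically stable with respect to initial states in $D$ and, if $X$ is connected (for instance $X = \mathbb{R}^n$), also with respect to all initial states in $X$. Here $C$ is called asymptotically stable with respect to initial states in $N \subseteq X$ if, with $\|y\|_C = \inf_{w \in C}\|y-w\|$ (and $\|y\|_C = \infty$ if $C = \emptyset$), it is uniformly stable, i.e. for every $\varepsilon > 0$ there is a $\delta > 0$ such that every solution with $x(0) \in N$ and $\|x(0)\|_C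 < \delta$ satisfies $\|x(t)\|_C < \varepsilon$ for all $t \ge 0$ in its interval of existence; and it is an attractor, i.e. there is a $\delta > 0$ such that from every $x_0 \in N$ with $\|x_0\|_C < \delta$ there starts a solution defined for all $t \ge 0$, and every such solution satisfies $\|x(t)\|_C \to 0$ as $t \to \infty$. -/

import Mathlib

open Set Filter Topology

namespace TypeIIZCBF

/-- The Euclidean space `ℝⁿ`. -/
abbrev E (n : ℕ) : Type := EuclideanSpace ℝ (Fin n)

/-- The constraint set `C = {x ∈ X : h x ≥ 0}`. -/
def safeSet {n : ℕ} (X : Set (E n)) (h : E n → ℝ) : Set (E n) :=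
  {x | x ∈ X ∧ 0 ≤ h x}

/-- The annulus `A = {x ∈ X : h x ∈ [-b, a]}`. -/
def annulus {n : ℕ} (X : Set (E n)) (h : E n → ℝ) (a b : ℝ) : Set (E n) :=
  {x | x ∈ X ∧ h x ∈ Icc (-b) a}

/-- `α : ℝ → ℝ` is continuous and its restriction to `[0, ∞)` is of class `K`
(strictly increasing and zero at zero). -/
structure IsTypeIIGain (α : ℝ → ℝ) : Prop where
  continuous : Continuous α
  strictMonoOn : StrictMonoOn α (Ici 0)
  map_zero : α 0 = 0

/-- The quantity `L_f h(x) + L_g h(x) v + α(h(x))` for a control value `v`. The control matrix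
`g x` is regarded as a linear map `ℝᵐ → ℝⁿ`. -/
noncomputable def barrierRate {n m : ℕ} (f : E n → E n) (g : E n → (E m →L[ℝ] E n))
    (h : E n → ℝ) (α : ℝ → ℝ) (x : E n) (v : E m) : ℝ :=
  fderiv ℝ h x (f x) + fderiv ℝ h x (g x v) + α (h x)

/-- `h` is a Type-II ZCBF for the given `α` and the given annulus (that is, the given `a`, `b`).
The supremum over the set `U` of admissible inputs is taken in the extended reals. -/
structure IsTypeIIZCBF {n m : ℕ} (X : Set (E n)) (U : Set (E m)) (f : E n → E n)
    (g : E n → (E m →L[ℝ] E n)) (h : E n → ℝ) (α : ℝ → ℝ) (a b : ℝ) : Prop where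
  a_pos : 0 < a
  b_pos : 0 < b
  gain : IsTypeIIGain α
  sup_nonneg : ∀ x ∈ annulus X h a b,
    (0 : EReal) ≤ ⨆ v ∈ U, ((barrierRate f g h α x v : ℝ) : EReal)

/-- The set `S(x)` of the inputs `v ∈ U` that satisfy the barrier inequality at `x` in case `x`
lies in the annulus. -/
def admissibleInputs {n m : ℕ} (X : Set (E n)) (U : Set (E m)) (f : E n → E n)
    (g : E n → (E m →L[ℝ] E n)) (h : E n → ℝ) (α : ℝ → ℝ) (a b : ℝ) (x : E n) : Set (E m) :=
  {v | v ∈ U ∧ (x ∈ annulus X h a b → 0 ≤ barrierRate f g h α x v)}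

/-- The closed-loop vector field `f(x) + g(x) u(x)`. -/
def closedLoop {n m : ℕ} (f : E n → E n) (g : E n → (E m →L[ℝ] E n)) (u : E n → E m) :
    E n → E n :=
  fun x => f x + g x (u x)

/-- `x` is a solution of `x' = F x` in `X` on the time interval `I`. -/
def IsSolutionOn {n : ℕ} (F : E n → E n) (X : Set (E n)) (x : ℝ → E n) (I : Set ℝ) : Prop :=
  ∀ t ∈ I, x t ∈ X ∧ HasDerivWithinAt x (F (x t)) I t

/-- The system `x' = F x` on `X` is safe with respect to `C`: every solution that starts in `C`
at time `0` stays in `C` for as long as it exists. All intervals of existence `I ⊆ [0, ∞)` with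
`0 ∈ I` are allowed, the maximal one among them. -/
def IsSafe {n : ℕ} (F : E n → E n) (X C : Set (E n)) : Prop :=
  ∀ (I : Set ℝ) (x : ℝ → E n), I.OrdConnected → I ⊆ Ici 0 → (0 : ℝ) ∈ I →
    IsSolutionOn F X x I → x 0 ∈ C → ∀ t ∈ I, x t ∈ C

/-- No solution of `x' = F x` in `X` can stay identically in `Ω`. -/
def NoSolutionStaysIn {n : ℕ} (F : E n → E n) (X Ω : Set (E n)) : Prop :=
  ∀ x : ℝ → E n, IsSolutionOn F X x (Ici 0) →
    ∀ τ₁ : ℝ, 0 ≤ τ₁ → x τ₁ ∈ Ω → ∃ τ₂ : ℝ, τ₁ < τ₂ ∧ x τ₂ ∉ Ω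

/-- `C` is uniformly stable for `x' = F x` on `X`, with initial states in `N`: for every `ε > 0`
there is a `δ > 0` such that solutions starting in `N` at distance less than `δ` from `C` stay at
distance less than `ε` from `C`. Here `Metric.thickening r C` is the set of all points whose
distance to `C` is less than `r`, with the distance to the empty set being infinite. -/
def IsUniformlyStable {n : ℕ} (F : E n → E n) (X N C : Set (E n)) : Prop :=
  ∀ ε : ℝ, 0 < ε → ∃ δ : ℝ, 0 < δ ∧
    ∀ (I : Set ℝ) (x : ℝ → E n), I.OrdConnected → I ⊆ Ici 0 → (0 : ℝ) ∈ I →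
      IsSolutionOn F X x I → x 0 ∈ N → x 0 ∈ Metric.thickening δ C →
        ∀ t ∈ I, x t ∈ Metric.thickening ε C

/-- `C` is an attractor for `x' = F x` on `X`, with initial states in `N`: for some `δ > 0`, from
every point of `N` at distance less than `δ` from `C` there starts a solution defined for all
`t ≥ 0`, and every such solution asymptotically approaches `C`. -/
def IsAttractor {n : ℕ} (F : E n → E n) (X N C : Set (E n)) : Prop :=
  ∃ δ : ℝ, 0 < δ ∧ ∀ x₀ ∈ N, x₀ ∈ Metric.thickening δ C →
    (∃ x : ℝ → E n, IsSolutionOn F X x (Ici 0) ∧ x 0 = x₀) ∧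
    ∀ x : ℝ → E n, IsSolutionOn F X x (Ici 0) → x 0 = x₀ →
      ∀ ε : ℝ, 0 < ε → ∃ T : ℝ, 0 < T ∧ ∀ t : ℝ, T ≤ t → x t ∈ Metric.thickening ε C

/-- `C` is asymptotically stable for `x' = F x` on `X`, with initial states in `N`. The notion
without restriction on the initial states is the case `N = X`. -/
def IsAsymptoticallyStable {n : ℕ} (F : E n → E n) (X N C : Set (E n)) : Prop :=
  IsUniformlyStable F X N C ∧ IsAttractor F X N C

end TypeIIZCBF

open TypeIIZCBF

/-!
Write `C = {h ≥ 0}`, `A = {-b ≤ h ≤ a}`, and let `F` be the closed-loop field, which is locally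
Lipschitz.

Safety is Nagumo's theorem (`mem_of_subtangential`). At a boundary point of `C` one has `h = 0`,
so the barrier inequality there reads `∇h · F ≥ 0`; as `∇h ≠ 0`, an arbitrarily small change of
`F` points strictly into `C` (`safeSet_subtangential`). A comparison argument with the inequality
`h' ≥ -α(h)` is not available, since `α` need not be Lipschitz.

For stability, the sign of `α` makes `h` nondecreasing along solutions in `{-b ≤ h < 0}`, and hence
keeps solutions that start in `{-b < h < 0}` in `C ∪ A` (`barrier_le_of_neg`). Compactness of `A`
makes "close to `C`" and "`h` not much below zero" equivalent in `A`, which gives uniform stability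
with respect to `C ∪ A`. Attractivity is LaSalle's principle (`exists_neg_lt_barrier`): if `h`
converged to a negative value along a solution outside `C`, its `ω`-limit set would contain a
trajectory on which `h` is constant, so one that stays in `Ω`.

Initial states in all of `X` reduce to those in `C ∪ A` once `{h < -b}` has positive distance from
`C` (`exists_pos_le_dist_sublevel`). This is not immediate, because `C` need not be compact and
both sets may come close to the boundary of `X` or to infinity. It follows from the connectedness
of `X` and the simple connectedness of `ℝⁿ`, by lifting a circle-valued map
(`IsPreconnected.not_ball_meets_both`).
-/

open TypeIIZCBF

/-! ### Separation of open sets near the boundary of a connected open set -/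

section Separation

variable {Y : Type*} [TopologicalSpace Y] {V : Type*} [NormedAddCommGroup V] [NormedSpace ℝ V]

/-- A continuous map from a real normed space to the circle lifts to `ℝ`. -/
theorem exists_continuous_real_lift {φ : V → UnitAddCircle} (hφ : Continuous φ) :
    ∃ ψ : V → ℝ, Continuous ψ ∧ ∀ y, (ψ y : UnitAddCircle) = φ y := by
  obtain ⟨e, he⟩ := QuotientAddGroup.mk_surjective (φ 0)
  obtain ⟨ψ, ⟨-, hψ⟩, -⟩ := (AddCircle.isCoveringMap_coe (1 : ℝ)).existsUnique_continuousMap_lifts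
    ⟨φ, hφ⟩ (a₀ := (0 : V)) (e₀ := e) he
  exact ⟨ψ, ψ.continuous, fun y => congrFun hψ y⟩

/-- A continuous function that only takes integer values on a preconnected set is constant
there. -/
theorem IsPreconnected.eq_of_coe_addCircle_eq_zero {S : Set Y} (hS : IsPreconnected S)
    {d : Y → ℝ} (hd : ContinuousOn d S) (h0 : ∀ y ∈ S, (d y : UnitAddCircle) = 0)
    {z w : Y} (hz : z ∈ S) (hw : w ∈ S) : d z = d w := by
  refine (AddCircle.isCoveringMap_coe (1 : ℝ)).eqOn_of_comp_eqOn hS (g₁ := d) (g₂ := fun _ => d w)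
    hd continuousOn_const (fun y hy => ?_) hw rfl hz
  exact (h0 y hy).trans (h0 w hw).symm

/-- The indicator of any set times a continuous function is continuous at a zero of that
function. -/
theorem continuousAt_indicator_of_eq_zero {P : Set Y} {ρ : Y → ℝ} (hρ : Continuous ρ) {y : Y}
    (hy : ρ y = 0) : ContinuousAt (P.indicator ρ) y := by
  have h0 : P.indicator ρ y = 0 := by
    by_cases h : y ∈ P <;> simp [h, hy]
  rw [ContinuousAt, h0]
  have hlim : Tendsto (fun v => |ρ v|) (𝓝 y) (𝓝 0) := by
    have := (hρ.abs).tendsto y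
    rwa [hy, abs_zero] at this
  refine squeeze_zero_norm (fun v => ?_) hlim
  by_cases h : v ∈ P <;> simp [h]

theorem continuousAt_indicator_of_mem {P : Set Y} (hP : IsOpen P) {ρ : Y → ℝ}
    (hρ : Continuous ρ) {y : Y} (hy : y ∈ P) : ContinuousAt (P.indicator ρ) y := by
  refine hρ.continuousAt.congr ?_
  filter_upwards [hP.mem_nhds hy] with v hv
  simp [hv]

theorem continuousAt_indicator_of_mem_disjoint {P M : Set Y} (hM : IsOpen M) (hPM : Disjoint P M)
    (ρ : Y → ℝ) {y : Y} (hy : y ∈ M) : ContinuousAt (P.indicator ρ) y := by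
  refine (continuousAt_const (y := (0 : ℝ))).congr ?_
  filter_upwards [hM.mem_nhds hy] with v hv
  rw [indicator_of_notMem (hPM.notMem_of_mem_right hv)]

/-- Let a connected set `X` be covered by two disjoint open sets `P`, `M` and a set `A` that
keeps distance `r` from the complement of `X`. Then no ball of radius `r` centred outside `X`
meets both `P` and `M`. This is a form of the unicoherence of normed spaces. With `ρ` rising from
`0` on `Xᶜ` to `1` at distance `r`, the function `ρ · 1_P` is continuous near `Xᶜ`, and
`(ρ - 1) · 1_P` is continuous on `X`. They agree modulo `ℤ`, hence define a circle-valued map,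
which lifts to `ℝ`. Comparing the lift with the first function on the ball and with the second one
on `X` gives different values for its increment from `P` to `M`. -/
theorem IsPreconnected.not_ball_meets_both {X P M A : Set V}
    (hXc : IsPreconnected X) (hP : IsOpen P) (hM : IsOpen M) (hPM : Disjoint P M)
    (hPX : P ⊆ X) (hMX : M ⊆ X) (hcov : X ⊆ P ∪ M ∪ A) {r : ℝ} (hr : 0 < r)
    (hA : ∀ y ∈ A, ∀ k ∉ X, r ≤ dist y k) {c z w : V} (hc : c ∉ X)
    (hz : z ∈ P) (hzc : dist z c < r) (hw : w ∈ M) (hwc : dist w c < r) : False := by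
  have hne : (Xᶜ).Nonempty := ⟨c, hc⟩
  set ρ : V → ℝ := fun y => min 1 (Metric.infDist y Xᶜ / r) with hρdef
  have hρ : Continuous ρ :=
    continuous_const.min ((Metric.continuous_infDist_pt _).div_const _)
  have hρ' : Continuous (fun y => ρ y - 1) := hρ.sub continuous_const
  have hρA : ∀ y ∈ A, ρ y = 1 := fun y hy => by
    have : r ≤ Metric.infDist y Xᶜ := (Metric.le_infDist hne).2 fun {k} hk => hA y hy k hk
    exact min_eq_left ((one_le_div hr).2 this)
  have hρX : ∀ y ∉ X, ρ y = 0 := fun y hy => by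
    simp [hρdef, Metric.infDist_zero_of_mem (show y ∈ Xᶜ from hy)]
  set σ : V → ℝ := P.indicator ρ
  set τ : V → ℝ := P.indicator (fun y => ρ y - 1)
  have hσ : ∀ y, ρ y < 1 → ContinuousAt σ y := fun y hy => by
    by_cases hyX : y ∈ X
    · rcases hcov hyX with (h | h) | h
      · exact continuousAt_indicator_of_mem hP hρ h
      · exact continuousAt_indicator_of_mem_disjoint hM hPM _ h
      · exact absurd (hρA y h) hy.ne
    · exact continuousAt_indicator_of_eq_zero hρ (hρX y hyX)
  have hτ : ∀ y ∈ X, ContinuousAt τ y := fun y hyX => by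
    rcases hcov hyX with (h | h) | h
    · exact continuousAt_indicator_of_mem hP hρ' h
    · exact continuousAt_indicator_of_mem_disjoint hM hPM _ h
    · exact continuousAt_indicator_of_eq_zero hρ' (by simp [hρA y h])
  have hστ : ∀ y, (σ y : UnitAddCircle) = (τ y : UnitAddCircle) := fun y => by
    by_cases h : y ∈ P
    · have : τ y + 1 = σ y := by simp [σ, τ, h]
      rw [← this, AddCircle.coe_add, AddCircle.coe_period, add_zero]
    · simp [σ, τ, h]
  have hφ : Continuous fun y => (σ y : UnitAddCircle) := by
    refine continuous_iff_continuousAt.2 fun y => ?_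
    by_cases hyX : y ∈ X
    · simp only [hστ]
      exact (AddCircle.continuous_mk' 1).continuousAt.comp (hτ y hyX)
    · exact (AddCircle.continuous_mk' 1).continuousAt.comp
        (hσ y (by rw [hρX y hyX]; exact one_pos))
  obtain ⟨ψ, hψ, hlift⟩ := exists_continuous_real_lift hφ
  have hball : ∀ y ∈ Metric.ball c r, ρ y < 1 := fun y hy =>
    min_lt_of_right_lt ((div_lt_one hr).2
      ((Metric.infDist_le_dist_of_mem (show c ∈ Xᶜ from hc)).trans_lt hy))
  have h1 : ψ z - σ z = ψ w - σ w :=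
    (convex_ball c r).isPreconnected.eq_of_coe_addCircle_eq_zero (d := fun y => ψ y - σ y)
      (fun y hy => (hψ.continuousAt.sub (hσ y (hball y hy))).continuousWithinAt)
      (fun y _ => by rw [AddCircle.coe_sub, hlift, sub_self]) hzc hwc
  have h2 : ψ z - τ z = ψ w - τ w :=
    hXc.eq_of_coe_addCircle_eq_zero (d := fun y => ψ y - τ y)
      (fun y hy => (hψ.continuousAt.sub (hτ y hy)).continuousWithinAt)
      (fun y _ => by rw [AddCircle.coe_sub, hlift, hστ, sub_self]) (hPX hz) (hMX hw)
  have hwP : w ∉ P := hPM.notMem_of_mem_right hw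
  have e1 : σ z = ρ z := indicator_of_mem hz _
  have e2 : τ z = ρ z - 1 := indicator_of_mem hz _
  have e3 : σ w = 0 := indicator_of_notMem hwP _
  have e4 : τ w = 0 := indicator_of_notMem hwP _
  linarith

/-- If `{-b ≤ h ≤ a}` is compact in the connected open set `X`, then `{h ≥ 0}` keeps a positive
distance from `{h < -b}`. A short segment from one set to the other either lies in `X`, so that it
meets the compact set `{0 ≤ h ≤ a}` close to `{h < -b}`, or it meets the complement of `X`, which
`IsPreconnected.not_ball_meets_both` excludes. -/
theorem exists_pos_le_dist_sublevel {X : Set V} (hX : IsOpen X) (hXc : IsPreconnected X)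
    {h : V → ℝ} (hh : ContinuousOn h X) {a b : ℝ} (ha : 0 < a) (hb : 0 < b)
    (hA : IsCompact {x | x ∈ X ∧ h x ∈ Icc (-b) a}) :
    ∃ δ > 0, ∀ z ∈ X, 0 ≤ h z → ∀ w ∈ X, h w < -b → δ ≤ dist z w := by
  have hopen : ∀ s : Set ℝ, IsOpen s → IsOpen (X ∩ h ⁻¹' s) :=
    fun s hs => hh.isOpen_inter_preimage hX hs
  obtain ⟨r, hr, hrX⟩ := hA.exists_thickening_subset_open hX fun x hx => hx.1
  obtain ⟨δ, hδ, hδA⟩ := (hA.inter_right (t := (X ∩ h ⁻¹' Iio 0)ᶜ)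
    (hopen _ isOpen_Iio).isClosed_compl).exists_thickening_subset_open
      (hopen _ (isOpen_Ioi (a := -b))) fun x hx =>
        ⟨hx.1.1, show -b < h x by
          have : ¬ h x < 0 := fun hneg => hx.2 ⟨hx.1.1, hneg⟩
          linarith⟩
  refine ⟨min r δ, lt_min hr hδ, fun z hz hz0 w hw hwb => ?_⟩
  by_contra! hzw
  have hzr : dist z w < r := hzw.trans_le (min_le_left _ _)
  have hzδ : dist z w < δ := hzw.trans_le (min_le_right _ _)
  have hseg : ∀ y ∈ segment ℝ z w, dist z y ≤ dist z w ∧ dist w y ≤ dist z w := fun y hy => by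
    have := dist_add_dist_of_mem_segment hy
    rw [dist_comm w y]
    constructor <;> linarith [dist_nonneg (x := z) (y := y), dist_nonneg (x := y) (y := w)]
  by_cases hsX : segment ℝ z w ⊆ X
  · obtain ⟨y, hy, hy0⟩ := (convex_segment z w).isPreconnected.intermediate_value
      (right_mem_segment ℝ z w) (left_mem_segment ℝ z w) (hh.mono hsX)
      (show (0 : ℝ) ∈ Icc (h w) (h z) from ⟨by linarith, hz0⟩)
    have hw' := hδA (Metric.mem_thickening_iff.2 ⟨y,
      ⟨⟨hsX hy, show h y ∈ Icc (-b) a by rw [hy0]; constructor <;> linarith⟩,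
        fun hn => absurd hn.2 (by simp [hy0])⟩, ((hseg y hy).2.trans_lt hzδ)⟩)
    exact absurd hwb (not_lt.2 (le_of_lt hw'.2))
  · obtain ⟨c, hcs, hc⟩ := not_subset.1 hsX
    have hAX : ∀ y ∈ {x | x ∈ X ∧ h x ∈ Icc (-b) a}, ∀ k ∉ X, r ≤ dist y k := by
      intro y hy k hk
      by_contra! hlt
      exact hk (hrX (Metric.mem_thickening_iff.2 ⟨y, hy, by rwa [dist_comm]⟩))
    have hza : a < h z := by
      by_contra! hle
      exact absurd ((hseg c hcs).1.trans_lt hzr)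
        (not_lt.2 (hAX z ⟨hz, by linarith, hle⟩ c hc))
    refine hXc.not_ball_meets_both (hopen _ (isOpen_Ioi (a := a)))
      (hopen _ (isOpen_Iio (a := -b))) ?_ inter_subset_left inter_subset_left ?_ hr hAX hc
      ⟨hz, hza⟩ ((hseg c hcs).1.trans_lt hzr) ⟨hw, hwb⟩ ((hseg c hcs).2.trans_lt hzr)
    · refine disjoint_left.2 fun x hx hx' => ?_
      have h1 : a < h x := hx.2
      have h2 : h x < -b := hx'.2
      linarith
    · intro x hx
      rcases lt_or_ge a (h x) with h1 | h1
      · exact Or.inl (Or.inl ⟨hx, h1⟩)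
      · rcases lt_or_ge (h x) (-b) with h2 | h2
        · exact Or.inl (Or.inr ⟨hx, h2⟩)
        · exact Or.inr ⟨hx, h2, h1⟩

end Separation

/-! ### Invariance of a closed set under a locally Lipschitz flow -/

section Invariance

theorem LocallyLipschitzOn.clm_apply {V W Z : Type*} [PseudoMetricSpace Z]
    [SeminormedAddCommGroup V] [NormedSpace ℝ V] [SeminormedAddCommGroup W] [NormedSpace ℝ W]
    {X : Set Z} {g : Z → V →L[ℝ] W} {u : Z → V}
    (hg : LocallyLipschitzOn X g) (hu : LocallyLipschitzOn X u) :
    LocallyLipschitzOn X fun x => g x (u x) := by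
  intro x hx
  obtain ⟨Kg, sg, hsg, hKg⟩ := hg hx
  obtain ⟨Ku, su, hsu, hKu⟩ := hu hx
  have hbg : ∀ᶠ y in 𝓝[X] x, ‖g y‖₊ < ‖g x‖₊ + 1 :=
    (hg.continuousOn x hx).nnnorm.eventually_lt_const (lt_add_one _)
  have hbu : ∀ᶠ y in 𝓝[X] x, ‖u y‖₊ < ‖u x‖₊ + 1 :=
    (hu.continuousOn x hx).nnnorm.eventually_lt_const (lt_add_one _)
  refine ⟨(‖g x‖₊ + 1) * Ku + Kg * (‖u x‖₊ + 1), _,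
    inter_mem (inter_mem hsg hsu) (inter_mem hbg hbu), LipschitzOnWith.of_dist_le_mul ?_⟩
  rintro y ⟨⟨hy1, hy2⟩, hy3, -⟩ z ⟨⟨hz1, hz2⟩, -, hz4⟩
  have hy3' : ‖g y‖ ≤ ‖g x‖ + 1 := le_of_lt (by exact_mod_cast hy3)
  have hz4' : ‖u z‖ ≤ ‖u x‖ + 1 := le_of_lt (by exact_mod_cast hz4)
  have h1 : ‖u y - u z‖ ≤ Ku * dist y z := by
    rw [← dist_eq_norm]; exact hKu.dist_le_mul y hy2 z hz2
  have h2 : ‖g y - g z‖ ≤ Kg * dist y z := by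
    rw [← dist_eq_norm]; exact hKg.dist_le_mul y hy1 z hz1
  calc dist (g y (u y)) (g z (u z)) = ‖g y (u y - u z) + (g y - g z) (u z)‖ := by
        rw [dist_eq_norm]; congr 1; simp
    _ ≤ ‖g y‖ * ‖u y - u z‖ + ‖g y - g z‖ * ‖u z‖ :=
        (norm_add_le _ _).trans (add_le_add ((g y).le_opNorm _) ((g y - g z).le_opNorm _))
    _ ≤ (‖g x‖ + 1) * (Ku * dist y z) + Kg * dist y z * (‖u x‖ + 1) := by gcongr
    _ = _ := by push_cast; ring

variable {V : Type*} [NormedAddCommGroup V] [NormedSpace ℝ V]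

/-- The right slope of the distance to `K` along a curve `x` with velocity `v` at time `t` is
eventually below any bound on `‖v - w‖`, if a straight motion with velocity `w` from a point of
`K` nearest to `x t` stays in `K` for a short time. -/
theorem eventually_slope_infDist_lt {K : Set V} {x : ℝ → V} {t ρ : ℝ} {v w q : V}
    (hx : HasDerivWithinAt x v (Ioi t) t) (hq : Metric.infDist (x t) K = dist (x t) q)
    (hw : ∀ᶠ s in 𝓝[>] (0 : ℝ), q + s • w ∈ K) (hρ : ‖v - w‖ < ρ) :
    ∀ᶠ z in 𝓝[>] t,
      (z - t)⁻¹ * (Metric.infDist (x z) K - Metric.infDist (x t) K) < ρ := by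
  have hslope : Tendsto (slope x t) (𝓝[>] t) (𝓝 v) := by
    have := hasDerivWithinAt_iff_tendsto_slope.1 hx
    rwa [sdiff_singleton_eq_self (by simp)] at this
  have hshift : Tendsto (fun z => z - t) (𝓝[>] t) (𝓝[>] 0) := by
    refine tendsto_nhdsWithin_iff.2 ⟨?_, ?_⟩
    · have : Tendsto (fun z : ℝ => z - t) (𝓝 t) (𝓝 (t - t)) :=
        (continuous_id.sub continuous_const).tendsto t
      rw [sub_self] at this
      exact this.mono_left nhdsWithin_le_nhds
    · filter_upwards [self_mem_nhdsWithin] with z hz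
      exact sub_pos.2 (mem_Ioi.1 hz)
  have hlt : ∀ᶠ z in 𝓝[>] t, ‖slope x t z - w‖ < ρ :=
    (hslope.sub_const w).norm.eventually_lt_const hρ
  filter_upwards [hlt, hshift.eventually hw, self_mem_nhdsWithin] with z hz hzK hzt
  have hpos : 0 < z - t := sub_pos.2 hzt
  have hle : Metric.infDist (x z) K ≤ dist (x t) q + (z - t) * ‖slope x t z - w‖ := by
    refine (Metric.infDist_le_dist_of_mem hzK).trans ?_
    have : x z - (q + (z - t) • w) = (x t - q) + (z - t) • (slope x t z - w) := by
      rw [smul_sub, sub_smul_slope, vsub_eq_sub]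
      abel
    rw [dist_eq_norm, this, dist_eq_norm]
    refine (norm_add_le _ _).trans ?_
    rw [norm_smul, Real.norm_of_nonneg hpos.le]
  rw [inv_mul_lt_iff₀ hpos, hq]
  have := mul_lt_mul_of_pos_left hz hpos
  linarith

variable [ProperSpace V]

/-- Nagumo's theorem for a locally Lipschitz vector field `F` on an open set `X` and a relatively
closed subset `C`: if `F` is approximated at each point of `C` by velocities that point into `C`,
then `C` is forward invariant. Near a point of `C`, the distance to `C` satisfies the differential
inequality `d' ≤ K d`, by Lipschitz continuity of `F` between a point and its projection. -/
theorem mem_of_subtangential {X C : Set V} {F : V → V} (hX : IsOpen X)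
    (hF : LocallyLipschitzOn X F) (hC : closure C ∩ X ⊆ C)
    (hsub : ∀ q ∈ C, ∀ ε > 0, ∃ w, ‖w - F q‖ ≤ ε ∧ ∀ᶠ s in 𝓝[>] (0 : ℝ), q + s • w ∈ C)
    {x : ℝ → V} {a b : ℝ}
    (hx : ∀ t ∈ Icc a b, x t ∈ X ∧ HasDerivWithinAt x (F (x t)) (Icc a b) t)
    (ha : x a ∈ C) : ∀ t ∈ Icc a b, x t ∈ C := by
  have hcont : ContinuousOn x (Icc a b) := fun t ht => (hx t ht).2.continuousWithinAt
  have hclosed : IsClosed ({t | x t ∈ C} ∩ Icc a b) := by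
    have : {t | x t ∈ C} ∩ Icc a b = Icc a b ∩ x ⁻¹' closure C := by
      ext t
      exact ⟨fun ht => ⟨ht.2, subset_closure ht.1⟩, fun ht => ⟨hC ⟨ht.2, (hx t ht.1).1⟩, ht.1⟩⟩
    rw [this]
    exact hcont.preimage_isClosed_of_isClosed isClosed_Icc isClosed_closure
  refine hclosed.Icc_subset_of_forall_mem_nhdsWithin ha ?_
  rintro t₀ ⟨hp, ht₀⟩
  have ht₀' : t₀ ∈ Icc a b := Ico_subset_Icc_self ht₀
  set p := x t₀
  have hpX : p ∈ X := (hx t₀ ht₀').1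
  obtain ⟨L, s, hs, hL⟩ := hF hpX
  rw [hX.nhdsWithin_eq hpX] at hs
  obtain ⟨R, hR, hRs⟩ := Metric.nhds_basis_closedBall.mem_iff.1 (inter_mem hs (hX.mem_nhds hpX))
  set K := C ∩ Metric.closedBall p R
  have hpK : p ∈ K := ⟨hp, Metric.mem_closedBall_self hR.le⟩
  have hKcl : IsClosed K := by
    refine isClosed_of_closure_subset fun y hy => ?_
    have hyB : y ∈ Metric.closedBall p R :=
      closure_minimal inter_subset_right Metric.isClosed_closedBall hy
    exact ⟨hC ⟨closure_mono inter_subset_left hy, (hRs hyB).2⟩, hyB⟩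
  have hKc : IsCompact K := (isCompact_closedBall p R).of_isClosed_subset hKcl inter_subset_right
  obtain ⟨t₁, ht₁, hnear⟩ : ∃ t₁ > t₀, ∀ t ∈ Ico t₀ t₁, t ∈ Icc a b ∧ dist (x t) p < R / 2 := by
    have h1 : ∀ᶠ t in 𝓝[≥] t₀, t ∈ Icc a b :=
      mem_of_superset (Ico_mem_nhdsGE ht₀.2) fun t ht => ⟨ht₀.1.trans ht.1, ht.2.le⟩
    have h2 : ∀ᶠ t in 𝓝[≥] t₀, dist (x t) p < R / 2 := by
      have : Tendsto x (𝓝[≥] t₀) (𝓝 p) :=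
        (hcont t₀ ht₀').mono_of_mem_nhdsWithin h1
      exact this.eventually (Metric.ball_mem_nhds p (half_pos hR))
    obtain ⟨t₁, ht₁, hsub⟩ := mem_nhdsGE_iff_exists_Ico_subset.1 (h1.and h2)
    exact ⟨t₁, ht₁, fun t ht => hsub ht⟩
  refine mem_of_superset (Ioo_mem_nhdsGT ht₁) fun t₂ ht₂ => ?_
  have hin : ∀ t ∈ Icc t₀ t₂, t ∈ Icc a b ∧ dist (x t) p < R / 2 :=
    fun t ht => hnear t ⟨ht.1, ht.2.trans_lt ht₂.2⟩
  have hd := le_gronwallBound_of_liminf_deriv_right_le (f := fun t => Metric.infDist (x t) K)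
    (f' := fun t => L * Metric.infDist (x t) K) (δ := 0) (K := L) (ε := 0) (a := t₀) (b := t₂)
    ((Metric.continuous_infDist_pt K).comp_continuousOn (hcont.mono fun t ht => (hin t ht).1))
    (fun t ht ρ hρ => ?_) (Metric.infDist_zero_of_mem hpK).le (fun t _ => by simp) t₂
    ⟨ht₂.1.le, le_rfl⟩
  · rw [gronwallBound_ε0_δ0] at hd
    exact ((hKcl.mem_iff_infDist_zero ⟨p, hpK⟩).2 (le_antisymm hd Metric.infDist_nonneg)).1
  · obtain ⟨htab, htp⟩ := hin t (Ico_subset_Icc_self ht)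
    obtain ⟨q, hqK, hq⟩ := hKc.exists_infDist_eq_dist ⟨p, hpK⟩ (x t)
    have hqp : dist q p < R := by
      have h1 : dist (x t) q ≤ dist (x t) p := hq ▸ Metric.infDist_le_dist_of_mem hpK
      linarith [dist_triangle_left q p (x t)]
    obtain ⟨w, hw, hwC⟩ := hsub q hqK.1 ((ρ - L * Metric.infDist (x t) K) / 2) (by linarith)
    have hwK : ∀ᶠ s in 𝓝[>] (0 : ℝ), q + s • w ∈ K := by
      have hlim : Tendsto (fun s : ℝ => q + s • w) (𝓝[>] 0) (𝓝 q) := by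
        have : Continuous fun s : ℝ => q + s • w := by fun_prop
        simpa using (this.tendsto 0).mono_left nhdsWithin_le_nhds
      filter_upwards [hwC, hlim.eventually (Metric.isOpen_ball.mem_nhds hqp)] with s h1 h2
      exact ⟨h1, Metric.ball_subset_closedBall h2⟩
    have htb : t < b := ht.2.trans_le (hin t₂ ⟨ht₂.1.le, le_rfl⟩).1.2
    have hder : HasDerivWithinAt x (F (x t)) (Ioi t) t :=
      (hx t htab).2.mono_of_mem_nhdsWithin
        (mem_of_superset (Ioo_mem_nhdsGT htb) fun y hy => ⟨htab.1.trans hy.1.le, hy.2.le⟩)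
    refine (eventually_slope_infDist_lt hder hq hwK ?_).frequently
    have hFq : ‖F (x t) - F q‖ ≤ L * Metric.infDist (x t) K := by
      rw [← dist_eq_norm, hq]
      exact hL.dist_le_mul _ (hRs (Metric.mem_closedBall.2 (by linarith))).1 _ (hRs hqK.2).1
    calc ‖F (x t) - w‖ ≤ ‖F (x t) - F q‖ + ‖F q - w‖ := norm_sub_le_norm_sub_add_norm_sub _ _ _
      _ < ρ := by rw [norm_sub_rev (F q)]; linarith

end Invariance

/-! ### Safety -/

section Safety

variable {n : ℕ} {X : Set (E n)} {h : E n → ℝ}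

theorem TypeIIZCBF.IsSolutionOn.mono {F : E n → E n} {x : ℝ → E n} {I J : Set ℝ}
    (hx : IsSolutionOn F X x I) (hJ : J ⊆ I) : IsSolutionOn F X x J :=
  fun t ht => ⟨(hx t (hJ ht)).1, (hx t (hJ ht)).2.mono hJ⟩

theorem TypeIIZCBF.IsSolutionOn.continuousOn {F : E n → E n} {x : ℝ → E n} {I : Set ℝ}
    (hx : IsSolutionOn F X x I) : ContinuousOn x I :=
  fun t ht => (hx t ht).2.continuousWithinAt

theorem TypeIIZCBF.IsSolutionOn.hasDerivWithinAt_comp {F : E n → E n} {x : ℝ → E n} {I : Set ℝ}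
    (hx : IsSolutionOn F X x I) (hd : ∀ y ∈ X, DifferentiableAt ℝ h y) {t : ℝ} (ht : t ∈ I) :
    HasDerivWithinAt (fun s => h (x s)) (fderiv ℝ h (x t) (F (x t))) I t :=
  (hd _ (hx t ht).1).hasFDerivAt.comp_hasDerivWithinAt t (hx t ht).2

theorem closure_safeSet_inter_subset (hX : IsOpen X) (hh : ContinuousOn h X) :
    closure (safeSet X h) ∩ X ⊆ safeSet X h := by
  rintro y ⟨hy, hyX⟩
  refine ⟨hyX, ?_⟩
  by_contra! hneg
  obtain ⟨z, hz, hzC⟩ := mem_closure_iff.1 hy _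
    (hh.isOpen_inter_preimage hX (isOpen_Iio (a := (0 : ℝ)))) ⟨hyX, hneg⟩
  exact absurd hzC.2 (not_le.2 hz.2)

/-- Velocities arbitrarily close to `F q` point into the safe set: at a boundary point, add to
`F q` a small multiple of a direction in which `h` increases. -/
theorem safeSet_subtangential (hX : IsOpen X) (hd : ∀ y ∈ X, DifferentiableAt ℝ h y)
    {F : E n → E n} (hgrad : ∀ x ∈ X ∩ frontier (safeSet X h), fderiv ℝ h x ≠ 0)
    (hF0 : ∀ y ∈ X, h y = 0 → 0 ≤ fderiv ℝ h y (F y)) :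
    ∀ q ∈ safeSet X h, ∀ ε > 0, ∃ w, ‖w - F q‖ ≤ ε ∧
      ∀ᶠ s in 𝓝[>] (0 : ℝ), q + s • w ∈ safeSet X h := by
  intro q hq ε hε
  have hlim : ∀ w : E n, Tendsto (fun s : ℝ => q + s • w) (𝓝[>] 0) (𝓝 q) := fun w => by
    have : Continuous fun s : ℝ => q + s • w := by fun_prop
    simpa using (this.tendsto 0).mono_left nhdsWithin_le_nhds
  by_cases hint : q ∈ interior (safeSet X h)
  · refine ⟨F q, by simpa using hε.le, ?_⟩
    filter_upwards [(hlim (F q)).eventually (isOpen_interior.mem_nhds hint)] with s hs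
    exact interior_subset hs
  have hne := hgrad q ⟨hq.1, subset_closure hq, hint⟩
  have hcont : ContinuousOn h X := fun y hy => (hd y hy).continuousAt.continuousWithinAt
  have hq0 : h q = 0 := by
    refine le_antisymm (le_of_not_gt fun hpos => hint ?_) hq.2
    exact mem_interior.2 ⟨_, fun y hy => ⟨hy.1, le_of_lt hy.2⟩,
      hcont.isOpen_inter_preimage hX (isOpen_Ioi (a := (0 : ℝ))), hq.1, hpos⟩
  obtain ⟨e, he⟩ : ∃ e, 0 < fderiv ℝ h q e := by
    obtain ⟨e, he⟩ := DFunLike.ne_iff.1 hne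
    rcases lt_or_gt_of_ne he with h1 | h1
    · exact ⟨-e, by rw [map_neg]; exact neg_pos.2 h1⟩
    · exact ⟨e, h1⟩
  have he0 : 0 < ‖e‖ := norm_pos_iff.2 fun h0 => by simp [h0] at he
  refine ⟨F q + (ε / ‖e‖) • e, ?_, ?_⟩
  · rw [add_sub_cancel_left, norm_smul, Real.norm_of_nonneg (by positivity),
      div_mul_cancel₀ _ he0.ne']
  set w := F q + (ε / ‖e‖) • e
  have hw : 0 < fderiv ℝ h q w := by
    rw [map_add, map_smul, smul_eq_mul]
    have := hF0 q hq.1 hq0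
    positivity
  have hline : HasDerivAt (fun s : ℝ => h (q + s • w)) (fderiv ℝ h q w) 0 := by
    have h1 : HasDerivAt (fun s : ℝ => q + s • w) w 0 := by
      simpa using ((hasDerivAt_id (0 : ℝ)).smul_const w).const_add q
    have h2 : HasFDerivAt h (fderiv ℝ h q) (q + (0 : ℝ) • w) := by
      simpa using (hd q hq.1).hasFDerivAt
    exact h2.comp_hasDerivAt 0 h1
  have hslope := hline.hasDerivWithinAt (s := Ioi 0)
  rw [hasDerivWithinAt_iff_tendsto_slope, sdiff_singleton_eq_self (by simp)] at hslope
  filter_upwards [hslope.eventually_const_lt hw, (hlim w).eventually (hX.mem_nhds hq.1),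
    self_mem_nhdsWithin] with s hs hsX hs0
  refine ⟨hsX, ?_⟩
  rw [slope_def_field] at hs
  have h1 : 0 < s := hs0
  rw [sub_zero, zero_smul, add_zero, hq0, sub_zero] at hs
  exact ((div_pos_iff_of_pos_right h1).1 hs).le

theorem mem_safeSet_of_isSolutionOn_Icc (hX : IsOpen X) (hd : ∀ y ∈ X, DifferentiableAt ℝ h y)
    {F : E n → E n} (hF : LocallyLipschitzOn X F)
    (hgrad : ∀ x ∈ X ∩ frontier (safeSet X h), fderiv ℝ h x ≠ 0)
    (hF0 : ∀ y ∈ X, h y = 0 → 0 ≤ fderiv ℝ h y (F y)) {x : ℝ → E n} {s t : ℝ}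
    (hx : IsSolutionOn F X x (Icc s t)) (hst : s ≤ t) (hs : x s ∈ safeSet X h) :
    x t ∈ safeSet X h :=
  mem_of_subtangential hX hF
    (closure_safeSet_inter_subset hX fun y hy => (hd y hy).continuousAt.continuousWithinAt)
    (safeSet_subtangential hX hd hgrad hF0) hx hs t ⟨hst, le_rfl⟩

end Safety

/-! ### Behaviour in the outer part of the annulus -/

section Annulus

variable {n : ℕ} {X : Set (E n)} {h : E n → ℝ} {F : E n → E n} {a b : ℝ}

/-- Along a solution with `h < 0` that starts in `{h > -b}`, the function `h` does not fall below
its initial value, if `h` has a nonnegative derivative along `F` on `{-b ≤ h < 0}`. -/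
theorem barrier_le_of_neg (hd : ∀ y ∈ X, DifferentiableAt ℝ h y)
    (hFA : ∀ y ∈ X, -b ≤ h y → h y < 0 → 0 ≤ fderiv ℝ h y (F y)) {x : ℝ → E n} {s t : ℝ}
    (hx : IsSolutionOn F X x (Icc s t)) (hst : s ≤ t) (hneg : ∀ r ∈ Icc s t, h (x r) < 0)
    (hs : -b < h (x s)) : h (x s) ≤ h (x t) := by
  by_contra! hlt
  -- `h ∘ x` stays above every line through `h (x s)` with negative slope `-ε` that does not
  -- leave `{h > -b}` before time `t`; the choice of `ε` makes this line end above `h (x t)`.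
  set d := min (h (x s) + b) ((h (x s) - h (x t)) / 2) with hddef
  have hd0 : 0 < d := lt_min (by linarith) (by linarith)
  set ε := d / (t - s + 1) with hεdef
  have hts : 0 < t - s + 1 := by linarith
  have hε : 0 < ε := div_pos hd0 hts
  have hεt : ∀ r ≤ t, ε * (r - s) ≤ d := fun r hr => by
    calc ε * (r - s) ≤ ε * (t - s + 1) := by gcongr; linarith
      _ = d := div_mul_cancel₀ _ hts.ne'
  have key := image_le_of_deriv_right_lt_deriv_boundary (f := fun r => -h (x r))
    (f' := fun r => -fderiv ℝ h (x r) (F (x r))) (a := s) (b := t)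
    (B := fun r => -h (x s) + ε * (r - s)) (B' := fun _ => ε)
    (fun r hr => (hx.hasDerivWithinAt_comp hd hr).neg.continuousWithinAt)
    (fun r hr => (hx.hasDerivWithinAt_comp hd (Ico_subset_Icc_self hr)).neg.mono_of_mem_nhdsWithin
      (mem_of_superset (Ico_mem_nhdsGE hr.2) fun y hy => ⟨hr.1.trans hy.1, hy.2.le⟩))
    (by simp)
    (fun r => by simpa using (((hasDerivAt_id r).sub_const s).const_mul ε).const_add (-h (x s)))
    (fun r hr hrB => ?_) (right_mem_Icc.2 hst)
  · have h1 := hεt t le_rfl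
    have h2 : d ≤ (h (x s) - h (x t)) / 2 := min_le_right _ _
    linarith
  · have hr' := Ico_subset_Icc_self hr
    have h1 := hεt r hr'.2
    have h2 : d ≤ h (x s) + b := min_le_left _ _
    have := hFA (x r) (hx r hr').1 (by linarith) (hneg r hr')
    linarith

/-- On a compact annulus, small negative values of `h` force the point close to the safe set. -/
theorem exists_mem_thickening_of_neg_lt (hh : ContinuousOn h X) (hb : 0 < b)
    (hA : IsCompact (annulus X h a b)) {ε : ℝ} (hε : 0 < ε) :
    ∃ η, 0 < η ∧ η ≤ b ∧ ∀ y ∈ annulus X h a b, -η < h y →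
      y ∈ Metric.thickening ε (safeSet X h) := by
  have hS : IsCompact (annulus X h a b \ Metric.thickening ε (safeSet X h)) :=
    hA.diff Metric.isOpen_thickening
  rcases (annulus X h a b \ Metric.thickening ε (safeSet X h)).eq_empty_or_nonempty with h0 | hne
  · exact ⟨b, hb, le_rfl, fun y hy _ => sdiff_eq_empty.1 h0 hy⟩
  obtain ⟨y₀, hy₀, hmax⟩ := hS.exists_isMaxOn hne (hh.mono fun y hy => hy.1.1)
  have hneg : h y₀ < 0 := by
    by_contra! hpos
    exact hy₀.2 (Metric.self_subset_thickening hε _ ⟨hy₀.1.1, hpos⟩)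
  refine ⟨-h y₀, neg_pos.2 hneg, by linarith [hy₀.1.2.1], fun y hy hlt => ?_⟩
  by_contra hfar
  have : h y ≤ h y₀ := hmax ⟨hy, hfar⟩
  linarith

/-- On a compact annulus, points close to the safe set have values of `h` that are not much
below zero. -/
theorem exists_neg_lt_of_mem_thickening (hX : IsOpen X) (hh : ContinuousOn h X)
    (hA : IsCompact (annulus X h a b)) {η : ℝ} (hη : 0 < η) :
    ∃ δ, 0 < δ ∧ ∀ y ∈ annulus X h a b, y ∈ Metric.thickening δ (safeSet X h) → -η < h y := by
  have hS : IsCompact (annulus X h a b ∩ (X ∩ h ⁻¹' Ioi (-η))ᶜ) :=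
    hA.inter_right (hh.isOpen_inter_preimage hX isOpen_Ioi).isClosed_compl
  obtain ⟨δ, hδ, hsub⟩ := hS.exists_thickening_subset_open
    (hh.isOpen_inter_preimage hX (isOpen_Iio (a := (0 : ℝ)))) fun y hy => ⟨hy.1.1, by
      have : ¬ -η < h y := fun hlt => hy.2 ⟨hy.1.1, hlt⟩
      show h y < 0
      linarith⟩
  refine ⟨δ, hδ, fun y hy hyC => ?_⟩
  by_contra hle
  obtain ⟨c, hc, hyc⟩ := Metric.mem_thickening_iff.1 hyC
  have := hsub (Metric.mem_thickening_iff.2 ⟨y, ⟨hy, fun hn => hle hn.2⟩, by rwa [dist_comm]⟩)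
  exact absurd hc.2 (not_le.2 this.2)

/-- The `ω`-limit set is invariant: if `q` is a cluster point of the solution `x` at infinity, then
so are the points of a solution `y` through `q`, as long as both stay in a set `K` on which `F`
is Lipschitz. -/
theorem mapClusterPt_of_isSolutionOn {K : Set (E n)} {L : NNReal} (hL : LipschitzOnWith L F K)
    {x y : ℝ → E n} (hx : IsSolutionOn F X x (Ici 0)) (hxK : ∀ t ≥ 0, x t ∈ K) {s t : ℝ}
    (hst : s ≤ t) (hy : IsSolutionOn F X y (Icc s t)) (hyK : ∀ r ∈ Icc s t, y r ∈ K)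
    (hs : MapClusterPt (y s) atTop x) : MapClusterPt (y t) atTop x := by
  rw [Metric.nhds_basis_ball.mapClusterPt_iff_frequently] at hs ⊢
  intro ε hε
  have hexp := Real.exp_pos (L * (t - s))
  have hfr := (hs (ε / Real.exp (L * (t - s))) (div_pos hε hexp)).and_eventually
    (eventually_ge_atTop 0)
  rw [frequently_atTop] at hfr ⊢
  intro T
  obtain ⟨τ, hτT, hτ, hτ0⟩ := hfr T
  refine ⟨τ + (t - s), by linarith, ?_⟩
  have hmem : ∀ r ∈ Icc s t, 0 ≤ τ + (r - s) := fun r hr => by linarith [hr.1]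
  have hshift : IsSolutionOn F X (fun r => x (τ + (r - s))) (Icc s t) := fun r hr => by
    refine ⟨(hx _ (hmem r hr)).1, ?_⟩
    have h1 : HasDerivWithinAt (fun r : ℝ => τ + (r - s)) 1 (Icc s t) r :=
      (((hasDerivAt_id r).sub_const s).const_add τ).hasDerivWithinAt
    have h2 := (hx _ (hmem r hr)).2.scomp r h1 hmem
    rw [one_smul] at h2
    exact h2
  have hright : ∀ z : ℝ → E n, IsSolutionOn F X z (Icc s t) →
      ∀ r ∈ Ico s t, HasDerivWithinAt z (F (z r)) (Ici r) r := fun z hz r hr =>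
    (hz r (Ico_subset_Icc_self hr)).2.mono_of_mem_nhdsWithin
      (mem_of_superset (Ico_mem_nhdsGE hr.2) fun y hy => ⟨hr.1.trans hy.1, hy.2.le⟩)
  have hdist := dist_le_of_trajectories_ODE_of_mem (v := fun _ => F) (s := fun _ => K) (K := L)
    (fun _ _ => hL) hshift.continuousOn (hright _ hshift)
    (fun r hr => hxK _ (hmem r (Ico_subset_Icc_self hr))) hy.continuousOn (hright _ hy)
    (fun r hr => hyK r (Ico_subset_Icc_self hr)) (le_refl _) t ⟨hst, le_rfl⟩
  refine Metric.mem_ball.2 (hdist.trans_lt ?_)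
  rw [← lt_div_iff₀ hexp]
  simpa using hτ

/-- LaSalle's principle in the annulus: along a solution that stays in `{h < 0}` and starts in
`{h > -b}`, `h` tends to zero from below. Otherwise `h` would be constant and
negative on the `ω`-limit set, which contains a full forward trajectory. -/
theorem exists_neg_lt_barrier (hd : ∀ y ∈ X, DifferentiableAt ℝ h y) (ha : 0 < a)
    (hF : LocallyLipschitzOn X F)
    (hFA : ∀ y ∈ X, -b ≤ h y → h y < 0 → 0 ≤ fderiv ℝ h y (F y))
    (hA : IsCompact (annulus X h a b))
    (hex : ∀ x₀ ∈ annulus X h a b, ∃ x : ℝ → E n, IsSolutionOn F X x (Ici 0) ∧ x 0 = x₀)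
    (hstay : NoSolutionStaysIn F X {x | x ∈ (safeSet X h ∪ annulus X h a b) \ safeSet X h ∧
      fderiv ℝ h x (F x) = 0})
    {x : ℝ → E n} (hx : IsSolutionOn F X x (Ici 0)) (hneg : ∀ t ≥ 0, h (x t) < 0)
    (h0 : -b < h (x 0)) {η : ℝ} (hη : 0 < η) : ∃ T > 0, ∀ t ≥ T, -η < h (x t) := by
  have hle : ∀ s t, 0 ≤ s → s ≤ t → -b < h (x s) → h (x s) ≤ h (x t) := fun s t hs hst hb =>
    barrier_le_of_neg hd hFA (hx.mono fun r hr => hs.trans hr.1) hst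
      (fun r hr => hneg r (hs.trans hr.1)) hb
  have hgt : ∀ t ≥ 0, -b < h (x t) := fun t ht => h0.trans_le (hle 0 t le_rfl ht h0)
  have hmono : ∀ s t, 0 ≤ s → s ≤ t → h (x s) ≤ h (x t) :=
    fun s t hs hst => hle s t hs hst (hgt s hs)
  have hxA : ∀ t ≥ 0, x t ∈ annulus X h a b := fun t ht =>
    ⟨(hx t ht).1, (hgt t ht).le, ((hneg t ht).trans ha).le⟩
  by_contra! hcon
  have hbound : ∀ t ≥ 0, h (x t) ≤ -η := fun t ht => by
    obtain ⟨s, hs, hle'⟩ := hcon (t + 1) (by linarith)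
    exact (hmono t s ht (by linarith)).trans hle'
  -- All cluster points `q` of `x` at infinity lie on the level `sup (h ∘ x)`.
  set c := sSup ((fun t => h (x t)) '' Ici 0) with hc
  have hbdd : BddAbove ((fun t => h (x t)) '' Ici 0) :=
    ⟨-η, by rintro _ ⟨t, ht, rfl⟩; exact hbound t ht⟩
  have hne : ((fun t => h (x t)) '' Ici 0).Nonempty := ⟨_, 0, self_mem_Ici, rfl⟩
  have hlec : ∀ t ≥ 0, h (x t) ≤ c := fun t ht => le_csSup hbdd ⟨t, ht, rfl⟩
  have hcη : c ≤ -η := csSup_le hne (by rintro _ ⟨t, ht, rfl⟩; exact hbound t ht)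
  have hbc : -b < c := h0.trans_le (hlec 0 le_rfl)
  have hlim : Tendsto (fun t => h (x t)) atTop (𝓝 c) := by
    refine tendsto_order.2 ⟨fun l hl => ?_, fun l hl => ?_⟩
    · obtain ⟨_, ⟨t, ht, rfl⟩, hlt⟩ := exists_lt_of_lt_csSup hne hl
      filter_upwards [eventually_ge_atTop t] with s hs
      exact hlt.trans_le (hmono t s ht hs)
    · filter_upwards [eventually_ge_atTop 0] with s hs
      exact (hlec s hs).trans_lt hl
  have hωA : ∀ q, MapClusterPt q atTop x → q ∈ annulus X h a b := fun q hq =>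
    hA.isClosed.mem_of_mapClusterPt hq
      ((eventually_ge_atTop 0).mono fun t ht => hxA t ht)
  have hωc : ∀ q, MapClusterPt q atTop x → h q = c := fun q hq => by
    have := hq.continuousAt_comp (hd q (hωA q hq).1).continuousAt
    have hnb : (𝓝 (h q) ⊓ 𝓝 c).NeBot := NeBot.mono this (inf_le_inf_left _ hlim)
    exact eq_of_nhds_neBot hnb
  obtain ⟨p, hpA, hp⟩ := hA.exists_mapClusterPt (f := atTop) (u := x)
    (tendsto_principal.2 ((eventually_ge_atTop 0).mono fun t ht => hxA t ht))
  obtain ⟨y, hy, hyp⟩ := hex p hpA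
  obtain ⟨L, hL⟩ := (hF.mono fun q hq => hq.1).exists_lipschitzOnWith_of_compact hA
  have hω : ∀ T ≥ 0, MapClusterPt (y T) atTop x := by
    intro T hT
    have hyT : IsSolutionOn F X y (Icc 0 T) := hy.mono fun t ht => ht.1
    have hclosed : IsClosed ({t | MapClusterPt (y t) atTop x} ∩ Icc 0 T) := by
      rw [inter_comm]
      exact hyT.continuousOn.preimage_isClosed_of_isClosed isClosed_Icc
        (t := {q | MapClusterPt q atTop x}) isClosed_setOfPred_clusterPt
    refine hclosed.Icc_subset_of_forall_mem_nhdsWithin (by rwa [mem_ofPred_eq, hyp]) ?_ ⟨hT, le_rfl⟩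
    rintro s ⟨hs, hsT⟩
    have hs0 : s ∈ Ici (0 : ℝ) := hsT.1
    have hhy : Tendsto (fun t => h (y t)) (𝓝[≥] s) (𝓝 c) := by
      have := ((hy.hasDerivWithinAt_comp hd hs0).continuousWithinAt.mono
        (Ici_subset_Ici.2 hsT.1)).tendsto
      rwa [hωc _ hs] at this
    obtain ⟨t₁, ht₁, hnear⟩ := mem_nhdsGE_iff_exists_Ico_subset.1
      (hhy.eventually (Ioo_mem_nhds hbc (show c < a by linarith)))
    refine mem_of_superset (Ioo_mem_nhdsGT ht₁) fun t ht => ?_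
    have hsub : ∀ r ∈ Icc s t, 0 ≤ r := fun r hr => hsT.1.trans hr.1
    refine mapClusterPt_of_isSolutionOn hL hx hxA ht.1.le (hy.mono hsub) (fun r hr => ?_) hs
    have hr' := hnear ⟨hr.1, hr.2.trans_lt ht.2⟩
    exact ⟨(hy r (hsub r hr)).1, hr'.1.le, hr'.2.le⟩
  have hΩ : ∀ t ≥ 0, y t ∈ {x | x ∈ (safeSet X h ∪ annulus X h a b) \ safeSet X h ∧
      fderiv ℝ h x (F x) = 0} := fun t ht => by
    refine ⟨⟨Or.inr (hωA _ (hω t ht)), fun hC => ?_⟩, ?_⟩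
    · have := hC.2
      rw [hωc _ (hω t ht)] at this
      linarith
    · have h1 := hy.hasDerivWithinAt_comp hd (show t ∈ Ici (0 : ℝ) from ht)
      have h2 : HasDerivWithinAt (fun s => h (y s)) 0 (Ici 0) t :=
        (hasDerivWithinAt_const t (Ici 0) c).congr (fun s hs => hωc _ (hω s hs)) (hωc _ (hω t ht))
      exact (uniqueDiffOn_Ici (0 : ℝ) t ht).eq_deriv _ h1 h2
  obtain ⟨τ, hτ, hout⟩ := hstay y hy 0 le_rfl (hΩ 0 le_rfl)
  exact hout (hΩ τ hτ.le)

end Annulus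

/-! ### Asymptotic stability -/

section Stability

variable {n : ℕ} {X : Set (E n)} {h : E n → ℝ} {F : E n → E n} {b : ℝ}

/-- A solution that starts in `{h > -b}` stays in the safe set together with the part of the
annulus on which `h` is at least its initial value. -/
theorem mem_safeSet_or_barrier_le (hd : ∀ y ∈ X, DifferentiableAt ℝ h y)
    (hFA : ∀ y ∈ X, -b ≤ h y → h y < 0 → 0 ≤ fderiv ℝ h y (F y)) {x : ℝ → E n} {I : Set ℝ}
    (hI : I.OrdConnected) (hI0 : I ⊆ Ici 0) (h0 : (0 : ℝ) ∈ I) (hx : IsSolutionOn F X x I)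
    (hsafe : ∀ s t, s ≤ t → IsSolutionOn F X x (Icc s t) → x s ∈ safeSet X h →
      x t ∈ safeSet X h) (hb : -b < h (x 0)) {t : ℝ} (ht : t ∈ I) :
    x t ∈ safeSet X h ∨ (h (x 0) ≤ h (x t) ∧ h (x t) < 0) := by
  have hsub : Icc 0 t ⊆ I := hI.out h0 ht
  by_cases hC : ∃ s ∈ Icc 0 t, 0 ≤ h (x s)
  · obtain ⟨s, hs, hsC⟩ := hC
    exact Or.inl (hsafe s t hs.2 (hx.mono fun r hr => hsub ⟨hs.1.trans hr.1, hr.2⟩)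
      ⟨(hx s (hsub hs)).1, hsC⟩)
  · push Not at hC
    exact Or.inr ⟨barrier_le_of_neg hd hFA (hx.mono hsub) (hI0 ht) hC hb, hC t ⟨hI0 ht, le_rfl⟩⟩

/-- Asymptotic stability only depends on the initial states close to the set. -/
theorem TypeIIZCBF.IsAsymptoticallyStable.of_inter_thickening_subset {C N N' : Set (E n)}
    (hst : IsAsymptoticallyStable F X N C) {ρ : ℝ} (hρ : 0 < ρ)
    (hN : N' ∩ Metric.thickening ρ C ⊆ N) : IsAsymptoticallyStable F X N' C := by
  refine ⟨fun ε hε => ?_, ?_⟩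
  · obtain ⟨δ, hδ, H⟩ := hst.1 ε hε
    refine ⟨min δ ρ, lt_min hδ hρ, fun I x hI hI0 h0 hx hxN hxC => ?_⟩
    exact H I x hI hI0 h0 hx
      (hN ⟨hxN, Metric.thickening_mono (min_le_right _ _) _ hxC⟩)
      (Metric.thickening_mono (min_le_left _ _) _ hxC)
  · obtain ⟨δ, hδ, H⟩ := hst.2
    refine ⟨min δ ρ, lt_min hδ hρ, fun x₀ hxN hxC => ?_⟩
    exact H x₀ (hN ⟨hxN, Metric.thickening_mono (min_le_right _ _) _ hxC⟩)
      (Metric.thickening_mono (min_le_left _ _) _ hxC)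

end Stability

theorem theorem1 {n m : ℕ}
    (X : Set (E n)) (hX : IsOpen X) (U : Set (E m))
    (f : E n → E n) (hf : LocallyLipschitzOn X f)
    (g : E n → (E m →L[ℝ] E n)) (hg : LocallyLipschitzOn X g)
    (h : E n → ℝ) (hh : ContDiffOn ℝ 1 h X)
    (α : ℝ → ℝ) (a b : ℝ) (hZ : IsTypeIIZCBF X U f g h α a b)
    (hgrad : ∀ x ∈ X ∩ frontier (safeSet X h), fderiv ℝ h x ≠ 0)
    (u : E n → E m) (hu : LocallyLipschitzOn X u)
    (huS : ∀ x ∈ X, u x ∈ admissibleInputs X U f g h α a b x) :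
    IsSafe (closedLoop f g u) X (safeSet X h) ∧
    (IsCompact (annulus X h a b) →
      (∀ r : ℝ, r < 0 → α r ≤ 0) →
      (∀ x₀ ∈ safeSet X h ∪ annulus X h a b, ∃ x : ℝ → E n,
        IsSolutionOn (closedLoop f g u) X x (Ici 0) ∧ x 0 = x₀ ∧
          Bornology.IsBounded (x '' Ici 0)) →
      IsPreconnected (safeSet X h ∪ annulus X h a b) →
      NoSolutionStaysIn (closedLoop f g u) X
        {x | x ∈ (safeSet X h ∪ annulus X h a b) \ safeSet X h ∧
          fderiv ℝ h x (closedLoop f g u x) = 0} →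
      IsAsymptoticallyStable (closedLoop f g u) X (safeSet X h ∪ annulus X h a b)
          (safeSet X h) ∧
        (IsPreconnected X →
          IsAsymptoticallyStable (closedLoop f g u) X X (safeSet X h))) := by
  have ha := hZ.a_pos
  have hb := hZ.b_pos
  set F := closedLoop f g u with hFdef
  have hF : LocallyLipschitzOn X F := hf.add (hg.clm_apply hu)
  have hd : ∀ y ∈ X, DifferentiableAt ℝ h y := fun y hy =>
    (hh.contDiffAt (hX.mem_nhds hy)).differentiableAt one_ne_zero
  have hrate : ∀ y ∈ annulus X h a b, 0 ≤ fderiv ℝ h y (F y) + α (h y) := fun y hy => by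
    have := (huS y hy.1).2 hy
    rwa [barrierRate, ← map_add] at this
  have hF0 : ∀ y ∈ X, h y = 0 → 0 ≤ fderiv ℝ h y (F y) := fun y hy hy0 => by
    have := hrate y ⟨hy, by rw [hy0]; constructor <;> linarith⟩
    rwa [hy0, hZ.gain.map_zero, add_zero] at this
  have hsafe : ∀ {x : ℝ → E n} {s t : ℝ}, IsSolutionOn F X x (Icc s t) → s ≤ t →
      x s ∈ safeSet X h → x t ∈ safeSet X h := fun hx hst hs =>
    mem_safeSet_of_isSolutionOn_Icc hX hd hF hgrad hF0 hx hst hs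
  refine ⟨fun I x hI hI0 h0 hx hxC t ht => hsafe (hx.mono (hI.out h0 ht)) (hI0 ht) hxC, ?_⟩
  intro hA hα hex _ hstay
  have hFA : ∀ y ∈ X, -b ≤ h y → h y < 0 → 0 ≤ fderiv ℝ h y (F y) := fun y hy h1 h2 => by
    have := hrate y ⟨hy, h1, (h2.trans ha).le⟩
    linarith [hα _ h2]
  have hex' : ∀ x₀ ∈ annulus X h a b, ∃ x : ℝ → E n, IsSolutionOn F X x (Ici 0) ∧ x 0 = x₀ :=
    fun x₀ hx₀ => (hex x₀ (Or.inr hx₀)).imp fun x hx => ⟨hx.1, hx.2.1⟩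
  have hcont : ContinuousOn h X := hh.continuousOn
  have hclose : ∀ η > 0, ∃ δ > 0, ∀ y ∈ safeSet X h ∪ annulus X h a b,
      y ∈ Metric.thickening δ (safeSet X h) → -η < h y := fun η hη => by
    obtain ⟨δ, hδ, H⟩ := exists_neg_lt_of_mem_thickening hX hcont hA hη
    refine ⟨δ, hδ, fun y hy hyC => hy.elim (fun hC => ?_) fun hyA => H y hyA hyC⟩
    linarith [hC.2]
  have hstable : IsAsymptoticallyStable F X (safeSet X h ∪ annulus X h a b) (safeSet X h) := by
    refine ⟨fun ε hε => ?_, ?_⟩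
    · obtain ⟨η, hη, hηb, hnear⟩ := exists_mem_thickening_of_neg_lt hcont hb hA hε
      obtain ⟨δ, hδ, hδη⟩ := hclose η hη
      refine ⟨δ, hδ, fun I x hI hI0 h0 hx hxD hxC t ht => ?_⟩
      have hx0 := hδη _ hxD hxC
      rcases mem_safeSet_or_barrier_le hd hFA hI hI0 h0 hx
        (fun s t hst hs => hsafe hs hst) (by linarith) ht with hC | ⟨h1, h2⟩
      · exact Metric.self_subset_thickening hε _ hC
      · exact hnear _ ⟨(hx t ht).1, by linarith, by linarith⟩ (by linarith)
    · obtain ⟨δ, hδ, hδb⟩ := hclose b hb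
      refine ⟨δ, hδ, fun x₀ hxD hxC =>
        ⟨(hex x₀ hxD).imp fun x hx => ⟨hx.1, hx.2.1⟩, fun x hx hx0 ε hε => ?_⟩⟩
      have hb0 : -b < h (x 0) := hx0 ▸ hδb x₀ hxD hxC
      by_cases hC : ∃ s ≥ 0, x s ∈ safeSet X h
      · obtain ⟨s, hs, hsC⟩ := hC
        refine ⟨s + 1, by linarith, fun t ht => Metric.self_subset_thickening hε _ ?_⟩
        exact hsafe (hx.mono fun r hr => hs.trans hr.1) (by linarith) hsC
      · push Not at hC
        have hneg : ∀ t ≥ 0, h (x t) < 0 := fun t ht =>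
          lt_of_not_ge fun hpos => hC t ht ⟨(hx t ht).1, hpos⟩
        obtain ⟨η, hη, hηb, hnear⟩ := exists_mem_thickening_of_neg_lt hcont hb hA hε
        obtain ⟨T, hT, hTη⟩ :=
          exists_neg_lt_barrier hd ha hF hFA hA hex' hstay hx hneg hb0 hη
        refine ⟨T, hT, fun t ht => hnear _ ⟨(hx t (hT.le.trans ht)).1, ?_, ?_⟩ (hTη t ht)⟩
        · linarith [hTη t ht]
        · linarith [hneg t (hT.le.trans ht)]
  refine ⟨hstable, fun hXc => ?_⟩
  obtain ⟨ρ, hρ, hdist⟩ := exists_pos_le_dist_sublevel hX hXc hcont ha hb hA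
  refine hstable.of_inter_thickening_subset hρ ?_
  rintro y ⟨hyX, hyC⟩
  obtain ⟨c, hc, hyc⟩ := Metric.mem_thickening_iff.1 hyC
  have hyb : -b ≤ h y := by
    by_contra! hlt
    exact absurd (hdist c hc.1 hc.2 y hyX hlt) (not_le.2 (by rwa [dist_comm]))
  rcases le_or_gt 0 (h y) with h0 | h0
  · exact Or.inl ⟨hyX, h0⟩
  · exact Or.inr ⟨hyX, hyb, (h0.trans ha).le⟩
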